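/- **Definitions.** An inverse semigroup is a semigroup $S$ in which every $s\in S$ has a unique $s^*\in S$ with $ss^*s=s$ and $s^*ss^*=s^*$. Its set of idempotents $E(S)$ is ordered by $e\le f\iff e=ef=fe$, and $(E(S),\le)$ is uniformly locally finite if $\sup_{e\in E(S)}|\{f\in E(S): f\le e\}|<\infty$. The maximal subgroup of $S$ at $p\in E(S)$ is $G_p=\{s\in S: ss^*=s^*s=p\}$. The Banach algebra $\ell^1(S)$ is the complex Banach space of absolutely summable functions $S\to\mathbb{C}$ with the convolution product $(f*g)(s)=\sum_{xy=s}f(x)g(y)$. For a Banach algebra $A$, let $A\otimes_p A$ be the completed projective tensor product, a Banach $A$-bimodule via $a\cdot(b\otimes c)=ab\otimes c$ and $(b\otimes c)\cdot a=b\otimes ca$, and let $\pi_A:A\otimes_pA\to A$ be the bounded linear map with $\pi_A(a\otimes b)=ab$. The algebra $A$ is *biprojective* if there is a bounded $A$-bimodule morphism $\rho:A\to A\otimes_pA$ with $\pi_A\circ\rho=\mathrm{id}_A$. It is *approximately biprojective* if there is a net $(\rho_\alpha)$ of continuous $A$-bimodule morphisms $A\to A\otimes_pA$ with $\pi_A(\rho_\alpha(a))\to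 a$ for every $a\in A$. **Theorem.** Let $S$ be an inverse semigroup such that $(E(S),\le)$ is uniformly locally finite. Then $\ell^1(S)$ is approximately biprojective if and only if it is biprojective. Moreover, $\ell^1(S)$ is approximately biprojective if and only if every maximal subgroup $G_p$ $(p\in E(S))$ of $S$ is finite. -/

import Mathlib

open scoped TensorProduct Topology

noncomputable section

/-! ### Inverse semigroups, their idempotents and maximal subgroups -/

/-- An inverse semigroup: every element `s` has exactly one generalized inverse, written `s⁻¹`. -/
class InverseSemigroup (S : Type*) extends Semigroup S, Inv S where
  mul_inv_mul : ∀ s : S, s * s⁻¹ * s = s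
  inv_mul_inv : ∀ s : S, s⁻¹ * s * s⁻¹ = s⁻¹
  inv_unique : ∀ s t : S, s * t * s = s → t * s * t = t → t = s⁻¹

/-- The set `E(S)` of idempotents of a semigroup, as a type. -/
def Idempotents (S : Type*) [Semigroup S] : Type _ := {e : S // IsIdempotentElem e}

/-- The order `e ≤ f ↔ e = e f = f e` on `E(S)`. -/
instance Idempotents.instPartialOrder (S : Type*) [Semigroup S] :
    PartialOrder (Idempotents S) where
  le e f := e.1 = e.1 * f.1 ∧ e.1 = f.1 * e.1
  le_refl e := ⟨e.2.eq.symm, e.2.eq.symm⟩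
  le_trans a b c hab hbc := by
    refine ⟨?_, ?_⟩
    · calc a.1 = a.1 * b.1 := hab.1
        _ = a.1 * (b.1 * c.1) := by rw [← hbc.1]
        _ = a.1 * c.1 := by rw [← mul_assoc, ← hab.1]
    · calc a.1 = b.1 * a.1 := hab.2
        _ = c.1 * b.1 * a.1 := by rw [← hbc.2]
        _ = c.1 * a.1 := by rw [mul_assoc, ← hab.2]
  le_antisymm a b hab hba := Subtype.ext (hab.1.trans hba.2.symm)

/-- A partially ordered set is uniformly locally finite if the cardinalities of the sets
`(x] = {y | y ≤ x}` are bounded by one natural number. -/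
def UniformlyLocallyFinite (α : Type*) [PartialOrder α] : Prop :=
  ∃ N : ℕ, ∀ x : α, (Set.Iic x).encard ≤ N

/-- The maximal subgroup `G_p = {s | s s⁻¹ = s⁻¹ s = p}` of `S` at the idempotent `p`. -/
def maximalSubgroup {S : Type*} [InverseSemigroup S] (p : Idempotents S) : Set S :=
  {s | s * s⁻¹ = p.1 ∧ s⁻¹ * s = p.1}

/-! ### The Banach algebra `ℓ¹(S)` -/

/-- The Banach space `ℓ¹(S)` of absolutely summable functions `S → ℂ` with norm `∑ |f s|`. -/
abbrev EllOne (S : Type*) : Type _ := lp (fun _ : S => ℂ) 1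

namespace EllOne

theorem summable_norm {S : Type*} (f : EllOne S) : Summable fun s => ‖f s‖ := by
  simpa using (lp.memℓp f).summable (by simp)

theorem norm_eq {S : Type*} (f : EllOne S) : ‖f‖ = ∑' s, ‖f s‖ := by
  simpa using lp.norm_eq_tsum_rpow (by simp) f

theorem summable_prod {S : Type*} (f g : EllOne S) :
    Summable fun p : S × S => ‖f p.1 * g p.2‖ :=
  (summable_norm f).mul_norm (summable_norm g)

variable {S : Type*} [Semigroup S]

/-- The convolution product `(f * g)(s) = ∑_{x y = s} f(x) g(y)`. -/
def convFun (f g : EllOne S) (s : S) : ℂ :=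
  ∑' p : {p : S × S // p.1 * p.2 = s}, f p.1.1 * g p.1.2

theorem summable_sigma (f g : EllOne S) :
    Summable fun q : (Σ s : S, {p : S × S // p.1 * p.2 = s}) => ‖f q.2.1.1 * g q.2.1.2‖ :=
  (Equiv.sigmaFiberEquiv (fun p : S × S => p.1 * p.2)).summable_iff.mpr (summable_prod f g)

theorem summable_fiber (f g : EllOne S) (s : S) :
    Summable fun p : {p : S × S // p.1 * p.2 = s} => ‖f p.1.1 * g p.1.2‖ :=
  (summable_sigma f g).sigma_factor s

theorem norm_convFun_le (f g : EllOne S) (s : S) :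
    ‖convFun f g s‖ ≤ ∑' p : {p : S × S // p.1 * p.2 = s}, ‖f p.1.1 * g p.1.2‖ :=
  norm_tsum_le_tsum_norm (summable_fiber f g s)

theorem summable_norm_convFun (f g : EllOne S) : Summable fun s => ‖convFun f g s‖ :=
  Summable.of_nonneg_of_le (fun _ => norm_nonneg _) (norm_convFun_le f g)
    (summable_sigma f g).sigma

theorem tsum_norm_convFun_le (f g : EllOne S) : ∑' s, ‖convFun f g s‖ ≤ ‖f‖ * ‖g‖ := by
  calc ∑' s, ‖convFun f g s‖
      ≤ ∑' s, ∑' p : {p : S × S // p.1 * p.2 = s}, ‖f p.1.1 * g p.1.2‖ :=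
        (summable_norm_convFun f g).tsum_le_tsum (norm_convFun_le f g) (summable_sigma f g).sigma
    _ = ∑' q : (Σ s : S, {p : S × S // p.1 * p.2 = s}), ‖f q.2.1.1 * g q.2.1.2‖ :=
        (summable_sigma f g).tsum_sigma.symm
    _ = ∑' p : S × S, ‖f p.1 * g p.2‖ :=
        (Equiv.sigmaFiberEquiv (fun p : S × S => p.1 * p.2)).tsum_eq
          (fun p : S × S => ‖f p.1 * g p.2‖)
    _ = ∑' p : S × S, ‖f p.1‖ * ‖g p.2‖ := by simp only [norm_mul]
    _ = ‖f‖ * ‖g‖ := by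
        rw [norm_eq, norm_eq, tsum_mul_tsum_of_summable_norm]
        · simpa using summable_norm f
        · simpa using summable_norm g

instance : Mul (EllOne S) where
  mul f g := ⟨convFun f g, memℓp_gen (by simpa using summable_norm_convFun f g)⟩

theorem mul_apply (f g : EllOne S) (s : S) :
    (f * g) s = ∑' p : {p : S × S // p.1 * p.2 = s}, f p.1.1 * g p.1.2 := rfl

theorem norm_mul_le' (f g : EllOne S) : ‖f * g‖ ≤ ‖f‖ * ‖g‖ := by
  rw [norm_eq (f * g)]
  exact tsum_norm_convFun_le f g

theorem add_mul' (f₁ f₂ g : EllOne S) : (f₁ + f₂) * g = f₁ * g + f₂ * g := by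
  ext s
  simp only [lp.coeFn_add, Pi.add_apply, mul_apply, add_mul]
  exact (summable_fiber f₁ g s).of_norm.tsum_add (summable_fiber f₂ g s).of_norm

theorem mul_add' (f g₁ g₂ : EllOne S) : f * (g₁ + g₂) = f * g₁ + f * g₂ := by
  ext s
  simp only [lp.coeFn_add, Pi.add_apply, mul_apply, mul_add]
  exact (summable_fiber f g₁ s).of_norm.tsum_add (summable_fiber f g₂ s).of_norm

theorem smul_mul' (c : ℂ) (f g : EllOne S) : (c • f) * g = c • (f * g) := by
  ext s
  simp only [lp.coeFn_smul, Pi.smul_apply, mul_apply, smul_eq_mul, mul_assoc, tsum_mul_left]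

theorem mul_smul' (c : ℂ) (f g : EllOne S) : f * (c • g) = c • (f * g) := by
  ext s
  simp only [lp.coeFn_smul, Pi.smul_apply, mul_apply, smul_eq_mul, mul_left_comm _ c,
    tsum_mul_left]

/-- Convolution as a bounded bilinear map. -/
def mulCLM : EllOne S →L[ℂ] EllOne S →L[ℂ] EllOne S :=
  LinearMap.mkContinuous₂ (LinearMap.mk₂ ℂ (· * ·) add_mul' smul_mul' mul_add' mul_smul') 1
    (fun f g => by simpa using norm_mul_le' f g)

theorem mulCLM_apply (f g : EllOne S) : mulCLM f g = f * g := rfl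

theorem single_mul_single [DecidableEq S] (x y : S) (a b : ℂ) :
    (lp.single 1 x a * lp.single 1 y b : EllOne S) = lp.single 1 (x * y) (a * b) := by
  ext s
  rw [mul_apply]
  by_cases h : x * y = s
  · rw [tsum_eq_single ⟨(x, y), h⟩]
    · subst h
      simp
    · rintro ⟨⟨u, v⟩, huv⟩ hne
      by_cases hu : u = x
      · have hv : v ≠ y := fun hv => hne (by subst hu hv; rfl)
        simp [hv]
      · simp [hu]
  · rw [lp.single_apply_ne _ _ _ (fun h' => h h'.symm)]
    convert tsum_zero with p
    obtain ⟨⟨u, v⟩, huv⟩ := p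
    by_cases hu : u = x
    · have hv : v ≠ y := fun hv => h (by subst hu hv; exact huv)
      simp [hv]
    · simp [hu]

theorem mul_assoc' (f g h : EllOne S) : f * g * h = f * (g * h) := by
  classical
  have h1 : ∀ (x y z : S) (a b c : ℂ),
      ((lp.single 1 x a * lp.single 1 y b : EllOne S) * lp.single 1 z c : EllOne S) =
        lp.single 1 x a * (lp.single 1 y b * lp.single 1 z c : EllOne S) := by
    intro x y z a b c
    simp only [single_mul_single, mul_assoc]
  have h2 : ∀ (x y : S) (a b : ℂ) (h : EllOne S),
      ((lp.single 1 x a * lp.single 1 y b : EllOne S) * h : EllOne S) =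
        lp.single 1 x a * (lp.single 1 y b * h : EllOne S) := by
    intro x y a b h
    have : mulCLM (lp.single 1 x a * lp.single 1 y b : EllOne S) =
        (mulCLM (lp.single 1 x a)).comp (mulCLM (lp.single 1 y b : EllOne S)) := by
      refine lp.ext_continuousLinearMap (by simp) fun z => ?_
      ext1
      exact h1 x y z a b 1
    exact congrArg (fun T : EllOne S →L[ℂ] EllOne S => T h) this
  have h3 : ∀ (x : S) (a : ℂ) (g h : EllOne S),
      ((lp.single 1 x a * g : EllOne S) * h : EllOne S) = lp.single 1 x a * (g * h) := by
    intro x a g h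
    have : (mulCLM.flip h).comp (mulCLM (lp.single 1 x a : EllOne S)) =
        (mulCLM (lp.single 1 x a)).comp (mulCLM.flip h) := by
      refine lp.ext_continuousLinearMap (by simp) fun y => ?_
      ext1
      exact h2 x y a 1 h
    exact congrArg (fun T : EllOne S →L[ℂ] EllOne S => T g) this
  have : (mulCLM.flip h).comp (mulCLM.flip g) = mulCLM.flip (g * h) := by
    refine lp.ext_continuousLinearMap (by simp) fun x => ?_
    ext1
    exact h3 x 1 g h
  exact congrArg (fun T : EllOne S →L[ℂ] EllOne S => T f) this

instance : NonUnitalNormedRing (EllOne S) where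
  __ := (inferInstance : NormedAddCommGroup (EllOne S))
  __ := (inferInstance : Mul (EllOne S))
  left_distrib := mul_add'
  right_distrib := add_mul'
  zero_mul g := (mulCLM.flip g).map_zero
  mul_zero f := (mulCLM f).map_zero
  mul_assoc := mul_assoc'
  norm_mul_le := norm_mul_le'

instance : IsScalarTower ℂ (EllOne S) (EllOne S) := ⟨fun c f g => smul_mul' c f g⟩

instance : SMulCommClass ℂ (EllOne S) (EllOne S) := ⟨fun c f g => (mul_smul' c f g).symm⟩

end EllOne

/-! ### Biprojectivity and approximate biprojectivity -/

section Biprojective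

variable (A : Type*) [NonUnitalNormedRing A] [NormedSpace ℂ A]

/-- The projective tensor product `A ⊗_p A`: the completion of the algebraic tensor product
for the projective tensor norm (carried by `⨂[ℂ] _ : Fin 2, A`). -/
abbrev ProjTensor : Type _ := UniformSpace.Completion (⨂[ℂ] _ : Fin 2, A)

variable {A}

/-- The elementary tensor `a ⊗ b` in `A ⊗_p A`. -/
def ProjTensor.tmul (a b : A) : ProjTensor A :=
  ((⨂ₜ[ℂ] i : Fin 2, ![a, b] i : ⨂[ℂ] _ : Fin 2, A) : ProjTensor A)

variable {F : Type*} [NormedAddCommGroup F] [NormedSpace ℂ F]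

/-- The unique extension to `A ⊗_p A` of a bounded linear map on the algebraic tensor product. -/
def ProjTensor.extend [CompleteSpace F] (T : (⨂[ℂ] _ : Fin 2, A) →L[ℂ] F) : ProjTensor A →L[ℂ] F :=
  T.extend UniformSpace.Completion.toComplL

theorem ProjTensor.extend_coe [CompleteSpace F] (T : (⨂[ℂ] _ : Fin 2, A) →L[ℂ] F)
    (x : ⨂[ℂ] _ : Fin 2, A) :
    ProjTensor.extend T (x : ProjTensor A) = T x :=
  T.extend_eq UniformSpace.Completion.denseRange_coe
    (UniformSpace.Completion.isUniformInducing_coe _) x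

theorem ProjTensor.ext_tmul {T₁ T₂ : ProjTensor A →L[ℂ] F}
    (h : ∀ a b : A, T₁ (ProjTensor.tmul a b) = T₂ (ProjTensor.tmul a b)) : T₁ = T₂ := by
  have hc : T₁.comp UniformSpace.Completion.toComplL =
      T₂.comp (UniformSpace.Completion.toComplL (𝕜 := ℂ) (E := ⨂[ℂ] _ : Fin 2, A)) := by
    rw [← ContinuousLinearMap.coe_inj]
    refine PiTensorProduct.ext (MultilinearMap.ext fun m => ?_)
    have hm : ![m 0, m 1] = m := by ext i; fin_cases i <;> rfl
    have := h (m 0) (m 1)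
    simp only [ProjTensor.tmul, hm] at this
    exact this
  ext x
  induction x using UniformSpace.Completion.induction_on with
  | hp => exact isClosed_eq T₁.continuous T₂.continuous
  | ih x => exact congrArg (fun T : (⨂[ℂ] _ : Fin 2, A) →L[ℂ] F => T x) hc

variable [IsScalarTower ℂ A A] [SMulCommClass ℂ A A]

/-- The left action `a · (b ⊗ c) = ab ⊗ c` on `A ⊗_p A`. -/
def ProjTensor.lact (a : A) : ProjTensor A →L[ℂ] ProjTensor A :=
  ProjTensor.extend (UniformSpace.Completion.toComplL.comp
    (PiTensorProduct.mapL ![ContinuousLinearMap.mul ℂ A a, ContinuousLinearMap.id ℂ A]))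

/-- The right action `(b ⊗ c) · a = b ⊗ ca` on `A ⊗_p A`. -/
def ProjTensor.ract (a : A) : ProjTensor A →L[ℂ] ProjTensor A :=
  ProjTensor.extend (UniformSpace.Completion.toComplL.comp
    (PiTensorProduct.mapL ![ContinuousLinearMap.id ℂ A, (ContinuousLinearMap.mul ℂ A).flip a]))

variable (A) in
/-- Multiplication of `A` as a continuous multilinear map in two variables. -/
def mulMultilinear : ContinuousMultilinearMap ℂ (fun _ : Fin 2 => A) A :=
  MultilinearMap.mkContinuous
    { toFun := fun m => m 0 * m 1
      map_update_add' := by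
        intro _ m i x y
        fin_cases i <;> simp [add_mul, mul_add, Function.update]
      map_update_smul' := by
        intro _ m i c x
        fin_cases i <;> simp [smul_mul_assoc, mul_smul_comm, Function.update] }
    1 (fun m => by simpa [Fin.prod_univ_two] using norm_mul_le (m 0) (m 1))

variable (A) in
/-- The product morphism `π_A : A ⊗_p A → A`, `π_A (a ⊗ b) = ab`. -/
def ProjTensor.prodMap [CompleteSpace A] : ProjTensor A →L[ℂ] A :=
  ProjTensor.extend (PiTensorProduct.liftIsometry ℂ (fun _ : Fin 2 => A) A (mulMultilinear A))

theorem ProjTensor.lact_tmul (a b c : A) :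
    ProjTensor.lact a (ProjTensor.tmul b c) = ProjTensor.tmul (a * b) c := by
  rw [ProjTensor.lact, ProjTensor.tmul, ProjTensor.extend_coe, ProjTensor.tmul]
  simp only [ContinuousLinearMap.comp_apply, UniformSpace.Completion.coe_toComplL,
    PiTensorProduct.mapL_apply, PiTensorProduct.map_tprod]
  congr 2
  ext i
  fin_cases i <;> rfl

theorem ProjTensor.ract_tmul (a b c : A) :
    ProjTensor.ract a (ProjTensor.tmul b c) = ProjTensor.tmul b (c * a) := by
  rw [ProjTensor.ract, ProjTensor.tmul, ProjTensor.extend_coe, ProjTensor.tmul]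
  simp only [ContinuousLinearMap.comp_apply, UniformSpace.Completion.coe_toComplL,
    PiTensorProduct.mapL_apply, PiTensorProduct.map_tprod]
  congr 2
  ext i
  fin_cases i <;> rfl

theorem ProjTensor.prodMap_tmul [CompleteSpace A] (a b : A) :
    ProjTensor.prodMap A (ProjTensor.tmul a b) = a * b := by
  rw [ProjTensor.prodMap, ProjTensor.tmul, ProjTensor.extend_coe,
    PiTensorProduct.liftIsometry_apply_apply, PiTensorProduct.lift.tprod]
  rfl

/-- `ρ : A → A ⊗_p A` is an `A`-bimodule morphism. -/
def IsBimoduleMorphism (ρ : A →L[ℂ] ProjTensor A) : Prop :=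
  ∀ a b : A, ρ (a * b) = ProjTensor.lact a (ρ b) ∧ ρ (a * b) = ProjTensor.ract b (ρ a)

end Biprojective

/-- A Banach algebra `A` is biprojective if `π_A` has a right inverse that is a bounded
`A`-bimodule morphism. -/
def IsBiprojective (A : Type*) [NonUnitalNormedRing A] [NormedSpace ℂ A]
    [IsScalarTower ℂ A A] [SMulCommClass ℂ A A] [CompleteSpace A] : Prop :=
  ∃ ρ : A →L[ℂ] ProjTensor A, IsBimoduleMorphism ρ ∧ ∀ a : A, ProjTensor.prodMap A (ρ a) = a

/-- A Banach algebra `A` is approximately biprojective if there is a net `(ρ_i)` of continuous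
`A`-bimodule morphisms `A → A ⊗_p A` with `π_A (ρ_i a) → a` for every `a`.
(Allowing directed index sets in larger universes gives the same notion, because pairs of a finite
subset of `A` and a positive integer always suffice to index such a net.) -/
def IsApproximatelyBiprojective.{u} (A : Type u) [NonUnitalNormedRing A] [NormedSpace ℂ A]
    [IsScalarTower ℂ A A] [SMulCommClass ℂ A A] [CompleteSpace A] : Prop :=
  ∃ (ι : Type u) (_ : Preorder ι) (_ : IsDirectedOrder ι) (_ : Nonempty ι)
    (ρ : ι → A →L[ℂ] ProjTensor A),
    (∀ i, IsBimoduleMorphism (ρ i)) ∧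
      ∀ a : A, Filter.Tendsto (fun i => ProjTensor.prodMap A (ρ i a)) Filter.atTop (𝓝 a)

end

/-! Every element of S has at most N elements below it in the natural partial order, so the zeta
transform `δ_s ↦ ∑_{t ≤ s} δ_t` is bounded on ℓ¹(S) and is the identity plus a nilpotent, hence
invertible. It turns convolution into convolution over the groupoid of S, where s and t compose only
when `s⁻¹ * s = t * t⁻¹` (`zeta_mul`). In the Möbius basis ⌊s⌋, the preimages of the point masses,
⌊s⌋⌊t⌋ is therefore ⌊st⌋ or 0.

If all maximal subgroups are finite, send ⌊s⌋ to the average of ⌊u⌋ ⊗ ⌊u⁻¹s⌋ over the finitely many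
arrows u from the range of s to a base point fixed for its 𝓓-class. Translation permutes these
arrows, so this is a bimodule morphism; each term multiplies back to ⌊s⌋, so it splits the product.

Conversely let `G_p` be infinite and ρ a bimodule morphism. From ⌊g⌋·ρ(⌊p⌋) = ρ(⌊g⌋) = ρ(⌊p⌋)·⌊g⌋
for g in `G_p`, the coefficients of ρ(⌊p⌋) are constant along the infinite orbits (gx, yg⁻¹). Being
summable, they vanish there, so π(ρ(⌊p⌋)) has coefficient 0 at ⌊p⌋ and no net of such products tends
to ⌊p⌋. -/

namespace InverseSemigroup

/-! ### Arithmetic of inverse semigroups -/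

variable {S : Type*} [InverseSemigroup S]

theorem inv_inv_eq (s : S) : s⁻¹⁻¹ = s :=
  (inv_unique s⁻¹ s (inv_mul_inv s) (mul_inv_mul s)).symm

theorem mul_inv_mul' (s : S) : s * (s⁻¹ * s) = s := by rw [← mul_assoc, mul_inv_mul]

theorem inv_mul_inv' (s : S) : s⁻¹ * (s * s⁻¹) = s⁻¹ := by rw [← mul_assoc, inv_mul_inv]

theorem mul_inv_mul_assoc (s x : S) : s * (s⁻¹ * (s * x)) = s * x := by
  rw [← mul_assoc, ← mul_assoc, mul_inv_mul]

theorem inv_mul_inv_assoc (s x : S) : s⁻¹ * (s * (s⁻¹ * x)) = s⁻¹ * x := by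
  rw [← mul_assoc, ← mul_assoc, inv_mul_inv]

theorem isIdempotentElem_mul_inv (s : S) : IsIdempotentElem (s * s⁻¹) := by
  rw [IsIdempotentElem, ← mul_assoc, mul_inv_mul]

theorem isIdempotentElem_inv_mul (s : S) : IsIdempotentElem (s⁻¹ * s) := by
  rw [IsIdempotentElem, ← mul_assoc, inv_mul_inv]

theorem inv_eq_self {e : S} (he : IsIdempotentElem e) : e⁻¹ = e :=
  (inv_unique e e (by rw [he.eq, he.eq]) (by rw [he.eq, he.eq])).symm

/-- With x the inverse of ef, fxe is also an inverse of ef, so x = fxe by uniqueness. This form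
makes x idempotent, hence its own inverse, and then ef = x. -/
theorem isIdempotentElem_mul {e f : S} (he : IsIdempotentElem e) (hf : IsIdempotentElem f) :
    IsIdempotentElem (e * f) := by
  have he' : ∀ x, e * (e * x) = e * x := fun x => by rw [← mul_assoc, he.eq]
  have hf' : ∀ x, f * (f * x) = f * x := fun x => by rw [← mul_assoc, hf.eq]
  have h1 := mul_inv_mul (e * f)
  have h2 := inv_mul_inv (e * f)
  set x := (e * f)⁻¹ with hx
  simp only [mul_assoc] at h1 h2
  have h2' : ∀ y, x * (e * (f * (x * y))) = x * y := fun y => by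
    simpa only [mul_assoc] using congrArg (· * y) h2
  have hfxe : f * (x * e) = x := by
    refine (inv_unique (e * f) _ ?_ ?_).trans hx.symm
    · simp only [mul_assoc, he', hf', h1]
    · simp only [mul_assoc, he', hf', h2']
  have hxx : IsIdempotentElem x := by
    have : f * (x * e) * (f * (x * e)) = f * (x * e) := by simp only [mul_assoc, h2']
    rwa [hfxe] at this
  have : e * f = x := by rw [← inv_inv_eq (e * f), ← hx, inv_eq_self hxx]
  rwa [this]

/-- Since ef and fe are idempotent, fe is an inverse of ef; but ef is its own inverse. -/
theorem idempotents_commute {e f : S} (he : IsIdempotentElem e) (hf : IsIdempotentElem f) :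
    e * f = f * e := by
  have he' : ∀ x, e * (e * x) = e * x := fun x => by rw [← mul_assoc, he.eq]
  have hf' : ∀ x, f * (f * x) = f * x := fun x => by rw [← mul_assoc, hf.eq]
  have h1 := (isIdempotentElem_mul he hf).eq
  have h2 := (isIdempotentElem_mul hf he).eq
  rw [← inv_eq_self (isIdempotentElem_mul he hf)]
  refine (inv_unique (e * f) (f * e) ?_ ?_).symm
  · simp only [mul_assoc, he', hf'] at h1 ⊢; exact h1
  · simp only [mul_assoc, he', hf'] at h2 ⊢; exact h2

theorem inv_mul_eq (s t : S) : (s * t)⁻¹ = t⁻¹ * s⁻¹ := by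
  have h := idempotents_commute (isIdempotentElem_mul_inv t) (isIdempotentElem_inv_mul s)
  refine (inv_unique (s * t) (t⁻¹ * s⁻¹) ?_ ?_).symm
  · calc s * t * (t⁻¹ * s⁻¹) * (s * t) = s * (t * t⁻¹ * (s⁻¹ * s)) * t := by simp only [mul_assoc]
      _ = s * t := by
        rw [h]; simp only [mul_assoc, mul_inv_mul_assoc, mul_inv_mul']
  · calc t⁻¹ * s⁻¹ * (s * t) * (t⁻¹ * s⁻¹) = t⁻¹ * (s⁻¹ * s * (t * t⁻¹)) * s⁻¹ := by
          simp only [mul_assoc]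
      _ = t⁻¹ * s⁻¹ := by
        rw [← h]; simp only [mul_assoc, inv_mul_inv_assoc, inv_mul_inv']

theorem inv_mul_cancel_of_eq {u x : S} (h : u⁻¹ * u = x * x⁻¹) : u⁻¹ * (u * x) = x := by
  rw [← mul_assoc, h, mul_inv_mul]

theorem mul_inv_cancel_of_eq {u x : S} (h : u * u⁻¹ = x * x⁻¹) : u * (u⁻¹ * x) = x := by
  rw [← mul_assoc, h, mul_inv_mul]

theorem mul_cancel_right_of_eq {x g : S} (h : x⁻¹ * x = g * g⁻¹) : x * g * g⁻¹ = x := by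
  rw [mul_assoc, ← h, mul_inv_mul']

theorem range_mul {s t : S} (h : s⁻¹ * s = t * t⁻¹) : s * t * (s * t)⁻¹ = s * s⁻¹ := by
  rw [inv_mul_eq, ← mul_assoc, mul_cancel_right_of_eq h]

theorem source_mul {s t : S} (h : s⁻¹ * s = t * t⁻¹) : (s * t)⁻¹ * (s * t) = t⁻¹ * t := by
  rw [inv_mul_eq, mul_assoc, inv_mul_cancel_of_eq h]

theorem range_idem {p : S} (hp : IsIdempotentElem p) : p * p⁻¹ = p := by
  rw [inv_eq_self hp, hp.eq]

theorem source_idem {p : S} (hp : IsIdempotentElem p) : p⁻¹ * p = p := by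
  rw [inv_eq_self hp, hp.eq]

/-! ### The natural partial order -/

/-- The principal order ideal of `s` for the natural partial order. -/
def below (s : S) : Set S := {t | t = t * t⁻¹ * s}

theorem self_mem_below (s : S) : s ∈ below s := (mul_inv_mul s).symm

theorem range_eq_of_mem_below {s t : S} (h : t ∈ below s) :
    t * t⁻¹ = t * t⁻¹ * (s * s⁻¹) := by
  have hc := idempotents_commute (isIdempotentElem_mul_inv t) (isIdempotentElem_mul_inv s)
  have h' : t = t * t⁻¹ * s := h
  have h2 : t⁻¹ = s⁻¹ * (t * t⁻¹) := by
    conv_lhs => rw [h', inv_mul_eq, inv_eq_self (isIdempotentElem_mul_inv t)]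
  calc t * t⁻¹ = (t * t⁻¹ * s) * (s⁻¹ * (t * t⁻¹)) := by rw [← h2, ← h']
    _ = t * t⁻¹ * ((s * s⁻¹) * (t * t⁻¹)) := by simp only [mul_assoc]
    _ = t * t⁻¹ * (s * s⁻¹) := by
      rw [← hc, ← mul_assoc, (isIdempotentElem_mul_inv t).eq]

theorem idem_mul_mem_below {e : S} (he : IsIdempotentElem e) (s : S) : e * s ∈ below s := by
  change e * s = e * s * (e * s)⁻¹ * s
  rw [inv_mul_eq, inv_eq_self he]
  calc e * s = e * e * (s * s⁻¹ * s) := by rw [he.eq, mul_inv_mul]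
    _ = e * (e * (s * s⁻¹)) * s := by simp only [mul_assoc]
    _ = e * (s * s⁻¹ * e) * s := by
      rw [idempotents_commute he (isIdempotentElem_mul_inv s)]
    _ = _ := by simp only [mul_assoc]

theorem below_trans {r s t : S} (hr : r ∈ below s) (hs : s ∈ below t) : r ∈ below t := by
  have hr' : r = r * r⁻¹ * s := hr
  have hs' : s = s * s⁻¹ * t := hs
  have : r = (r * r⁻¹ * (s * s⁻¹)) * t := by
    rw [mul_assoc, ← hs', ← hr']
  rw [this]
  exact idem_mul_mem_below
    (isIdempotentElem_mul (isIdempotentElem_mul_inv r) (isIdempotentElem_mul_inv s)) t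

theorem below_antisymm {s t : S} (hs : s ∈ below t) (ht : t ∈ below s) : s = t := by
  have h1 := range_eq_of_mem_below hs
  have h2 := range_eq_of_mem_below ht
  rw [idempotents_commute (isIdempotentElem_mul_inv t) (isIdempotentElem_mul_inv s), ← h1] at h2
  have hs' : s = s * s⁻¹ * t := hs
  rw [hs', ← h2, mul_inv_mul]

/-- An element t below s is recovered from its range by `t = t * t⁻¹ * s`, so taking ranges embeds
the ideal of s into that of `s * s⁻¹`. This carries the bound from E(S) to S. -/
theorem encard_below_le {N : ℕ} (hN : ∀ x : Idempotents S, (Set.Iic x).encard ≤ N) (s : S) :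
    (below s).encard ≤ N := by
  refine le_trans ?_ (hN ⟨s * s⁻¹, isIdempotentElem_mul_inv s⟩)
  refine Set.encard_le_encard_of_injOn
    (f := fun t => (⟨t * t⁻¹, isIdempotentElem_mul_inv t⟩ : Idempotents S)) ?_ ?_
  · intro t ht
    have h := range_eq_of_mem_below ht
    refine ⟨h, ?_⟩
    change t * t⁻¹ = s * s⁻¹ * (t * t⁻¹)
    rwa [idempotents_commute (isIdempotentElem_mul_inv s) (isIdempotentElem_mul_inv t)]
  · intro t ht u hu htu
    have h : t * t⁻¹ = u * u⁻¹ := congrArg Subtype.val htu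
    have ht' : t = t * t⁻¹ * s := ht
    have hu' : u = u * u⁻¹ * s := hu
    rw [ht', h, ← hu']

/-- An element below `s * t` is uniquely a composable product of elements below `s` and `t`. -/
theorem below_mul_factor {s t r : S} (hr : r ∈ below (s * t)) :
    r * r⁻¹ * s ∈ below s ∧ s⁻¹ * r ∈ below t ∧
      (r * r⁻¹ * s)⁻¹ * (r * r⁻¹ * s) = (s⁻¹ * r) * (s⁻¹ * r)⁻¹ ∧
      r * r⁻¹ * s * (s⁻¹ * r) = r := by
  have hf := isIdempotentElem_mul_inv r
  have hr' : r = r * r⁻¹ * (s * t) := hr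
  have hss : s * (s⁻¹ * r) = r := by
    conv_lhs => rw [hr']
    rw [← mul_assoc, ← mul_assoc, idempotents_commute (isIdempotentElem_mul_inv s) hf]
    conv_rhs => rw [hr']
    simp only [mul_assoc, mul_inv_mul_assoc]
  have hsrc : (r * r⁻¹ * s)⁻¹ * (r * r⁻¹ * s) = (s⁻¹ * r) * (s⁻¹ * r)⁻¹ := by
    rw [inv_mul_eq, inv_mul_eq s⁻¹ r, inv_inv_eq, inv_eq_self hf]
    simp only [mul_assoc, mul_inv_mul_assoc]
  refine ⟨idem_mul_mem_below hf s, ?_, hsrc, by rw [mul_assoc, hss, mul_inv_mul]⟩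
  have : s⁻¹ * r = (s⁻¹ * r) * (s⁻¹ * r)⁻¹ * t := by
    rw [← hsrc, inv_mul_eq, inv_eq_self hf]
    conv_lhs => rw [hr', ← hf.eq]
    simp only [mul_assoc]
  exact this

/-- Converse to `below_mul_factor`: together they match the ideal of st with the composable pairs
below s and t. -/
theorem mul_mem_below {s t x y : S} (hx : x ∈ below s) (hy : y ∈ below t)
    (h : x⁻¹ * x = y * y⁻¹) :
    x * y ∈ below (s * t) ∧ x * y * (x * y)⁻¹ * s = x ∧ s⁻¹ * (x * y) = y := by
  have hx' : x = x * x⁻¹ * s := hx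
  have hy' : y = y * y⁻¹ * t := hy
  have hxi : x⁻¹ * x = s⁻¹ * x := by
    conv_lhs => rw [hx', inv_mul_eq, inv_eq_self (isIdempotentElem_mul_inv x)]
    conv_rhs => rw [hx']
    rw [mul_assoc s⁻¹, ← mul_assoc (x * x⁻¹) (x * x⁻¹), (isIdempotentElem_mul_inv x).eq]
  refine ⟨?_, by rw [range_mul h, ← hx'], ?_⟩
  · change x * y = x * y * (x * y)⁻¹ * (s * t)
    rw [range_mul h, ← mul_assoc, ← hx']
    conv_lhs => rw [hy', ← h]
    rw [← mul_assoc, mul_inv_mul']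
  · rw [← mul_assoc, ← hxi, h, mul_inv_mul]

end InverseSemigroup

/-! ### Point masses and the universal property of ℓ¹ -/

namespace EllOne

variable {S : Type*}

open Classical in
/-- The point mass at `s`. -/
noncomputable def delta (s : S) : EllOne S := lp.single 1 s 1

theorem norm_delta (s : S) : ‖delta s‖ = 1 := by
  simp [delta, lp.norm_single]

theorem delta_self (s : S) : delta s s = 1 := by
  simp [delta]

theorem delta_ne {s t : S} (h : t ≠ s) : delta s t = 0 := by
  simp [delta, h]

theorem delta_mul_delta [Semigroup S] (s t : S) : delta s * delta t = delta (s * t) := by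
  simp [delta, single_mul_single]

variable {F : Type*} [NormedAddCommGroup F] [NormedSpace ℂ F]

theorem hasSum_delta (f : EllOne S) : HasSum (fun s => f s • delta s) f := by
  classical
  have := lp.hasSum_single (p := 1) (by simp) f
  convert this using 2 with s
  rw [delta, ← lp.single_smul]
  simp

theorem ext_delta {T₁ T₂ : EllOne S →L[ℂ] F} (h : ∀ s, T₁ (delta s) = T₂ (delta s)) :
    T₁ = T₂ := by
  ext1 f
  have h1 := (hasSum_delta f).mapL T₁
  have h2 := (hasSum_delta f).mapL T₂
  simp only [map_smul, h] at h1 h2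
  exact h1.unique h2

variable [CompleteSpace F]

/-- The universal property of `ℓ¹`: the bounded linear map taking prescribed bounded values on
point masses. -/
noncomputable def lift (v : S → F) (C : ℝ) (hv : ∀ s, ‖v s‖ ≤ C) : EllOne S →L[ℂ] F :=
  have hs : ∀ f : EllOne S, Summable fun s => ‖f s • v s‖ := fun f =>
    Summable.of_nonneg_of_le (fun _ => norm_nonneg _)
      (fun s => by rw [norm_smul]; exact mul_le_mul_of_nonneg_left (hv s) (norm_nonneg _))
      ((summable_norm f).mul_right C)
  LinearMap.mkContinuous
    { toFun := fun f => ∑' s, f s • v s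
      map_add' := fun f g => by
        simp only [lp.coeFn_add, Pi.add_apply, add_smul]
        exact (hs f).of_norm.tsum_add (hs g).of_norm
      map_smul' := fun c f => by
        simp only [lp.coeFn_smul, Pi.smul_apply, smul_eq_mul, mul_smul, RingHom.id_apply]
        exact (hs f).of_norm.tsum_const_smul c } C
    (fun f => by
      change ‖∑' s, f s • v s‖ ≤ C * ‖f‖
      refine (norm_tsum_le_tsum_norm (hs f)).trans ?_
      rw [norm_eq, mul_comm, ← tsum_mul_right]
      refine (hs f).tsum_le_tsum (fun s => ?_) ((summable_norm f).mul_right C)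
      rw [norm_smul]
      exact mul_le_mul_of_nonneg_left (hv s) (norm_nonneg _))

theorem lift_apply (v : S → F) (C : ℝ) (hv : ∀ s, ‖v s‖ ≤ C) (f : EllOne S) :
    lift v C hv f = ∑' s, f s • v s := rfl

theorem lift_delta (v : S → F) (C : ℝ) (hv : ∀ s, ‖v s‖ ≤ C) (s : S) :
    lift v C hv (delta s) = v s := by
  rw [lift_apply, tsum_eq_single s (fun t ht => by rw [delta_ne ht, zero_smul]), delta_self,
    one_smul]

theorem norm_lift_le (v : S → F) (C : ℝ) (hC : 0 ≤ C) (hv : ∀ s, ‖v s‖ ≤ C) :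
    ‖lift v C hv‖ ≤ C := by
  unfold lift
  exact LinearMap.mkContinuous_norm_le _ hC _

end EllOne

namespace EllOne

open InverseSemigroup

/-! ### Zeta and Möbius transforms -/

section Zeta

variable {S : Type*} [InverseSemigroup S] {N : ℕ} (hN : ∀ s : S, (below s).encard ≤ N)

theorem norm_sum_delta_le (F : Finset S) : ‖∑ t ∈ F, delta t‖ ≤ F.card := by
  refine (norm_sum_le _ _).trans ?_
  simp [norm_delta]

/-- The order ideal of `s` as a finite set. -/
noncomputable def ideal (s : S) : Finset S :=
  (Set.finite_of_encard_le_coe (hN s)).toFinset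

theorem mem_ideal {s t : S} : t ∈ ideal hN s ↔ t ∈ below s := by simp [ideal]

theorem card_ideal_le (s : S) : (ideal hN s).card ≤ N := by
  have h := hN s
  rw [(Set.finite_of_encard_le_coe h).encard_eq_coe_toFinset_card] at h
  exact_mod_cast h

-- By antisymmetry s is not below t, so ideal size serves as a strictly decreasing rank.
open Classical in
theorem card_ideal_lt {s t : S} (h : t ∈ (ideal hN s).erase s) :
    (ideal hN t).card < (ideal hN s).card := by
  obtain ⟨hne, hm⟩ := Finset.mem_erase.mp h
  rw [mem_ideal] at hm
  refine Finset.card_lt_card ⟨fun r hr => ?_, fun hsub => hne ?_⟩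
  · rw [mem_ideal] at hr ⊢
    exact below_trans hr hm
  · exact below_antisymm hm
      ((mem_ideal hN).mp (hsub ((mem_ideal hN).mpr (self_mem_below s))))

/-- The zeta transform `δ_s ↦ ∑_{t ≤ s} δ_t`. -/
noncomputable def zeta : EllOne S →L[ℂ] EllOne S :=
  lift (fun s => ∑ t ∈ ideal hN s, delta t) N fun s =>
    (norm_sum_delta_le _).trans (by exact_mod_cast card_ideal_le hN s)

theorem zeta_delta (s : S) : zeta hN (delta s) = ∑ t ∈ ideal hN s, delta t :=
  lift_delta _ _ _ s

open Classical in
/-- The strict zeta transform `δ_s ↦ ∑_{t < s} δ_t`. -/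
noncomputable def strictZeta : EllOne S →L[ℂ] EllOne S :=
  lift (fun s => ∑ t ∈ (ideal hN s).erase s, delta t) N fun s =>
    (norm_sum_delta_le _).trans
      (Nat.cast_le.mpr
      ((Finset.card_le_card (Finset.erase_subset _ _)).trans (card_ideal_le hN s)))

open Classical in
theorem strictZeta_delta (s : S) :
    strictZeta hN (delta s) = ∑ t ∈ (ideal hN s).erase s, delta t :=
  lift_delta _ _ _ s

theorem zeta_eq : zeta hN = 1 + strictZeta hN := by
  classical
  refine ext_delta fun s => ?_
  rw [zeta_delta, add_apply, strictZeta_delta,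
    one_apply_eq_self]
  exact (Finset.add_sum_erase _ _ ((mem_ideal hN).mpr (self_mem_below s))).symm

/-- Each application replaces a point mass by a sum of point masses with strictly smaller ideals, so
the ideal size bounds the number of possible steps. -/
theorem strictZeta_pow_delta (k : ℕ) :
    ∀ s : S, (ideal hN s).card ≤ k → (strictZeta hN ^ k) (delta s) = 0 := by
  classical
  induction k with
  | zero =>
    intro s hs
    -- The base case is vacuous: no ideal is empty.
    have : s ∈ ideal hN s := (mem_ideal hN).mpr (self_mem_below s)
    rw [Finset.card_eq_zero.mp (Nat.le_zero.mp hs)] at this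
    simp at this
  | succ k ih =>
    intro s hs
    rw [pow_succ, mul_apply_eq_comp, strictZeta_delta, map_sum]
    refine Finset.sum_eq_zero fun t ht => ih t ?_
    have := card_ideal_lt hN ht
    omega

/-- Uniformity of the bound matters here: the single exponent N kills the strict part on all point
masses at once, so the operator itself is nilpotent. -/
theorem isUnit_zeta : IsUnit (zeta hN) := by
  rw [zeta_eq]
  refine IsNilpotent.isUnit_one_add ⟨N, ext_delta fun s => ?_⟩
  rw [strictZeta_pow_delta hN N s (card_ideal_le hN s)]
  rfl

/-- The Möbius transform, inverse to the zeta transform. -/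
noncomputable def moebius : EllOne S →L[ℂ] EllOne S := ((isUnit_zeta hN).unit⁻¹ : (_)ˣ)

theorem zeta_moebius (f : EllOne S) : zeta hN (moebius hN f) = f :=
  congrArg (fun T : EllOne S →L[ℂ] EllOne S => T f) (isUnit_zeta hN).mul_val_inv

theorem moebius_zeta (f : EllOne S) : moebius hN (zeta hN f) = f :=
  congrArg (fun T : EllOne S →L[ℂ] EllOne S => T f) (isUnit_zeta hN).val_inv_mul

/-- The Möbius basis of `ℓ¹(S)`. -/
noncomputable def basis (s : S) : EllOne S := moebius hN (delta s)

theorem zeta_basis (s : S) : zeta hN (basis hN s) = delta s := zeta_moebius hN _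

theorem norm_basis_le (s : S) : ‖basis hN s‖ ≤ ‖moebius hN‖ := by
  simpa [norm_delta, basis] using (moebius hN).le_opNorm (delta s)

theorem ext_basis {F : Type*} [NormedAddCommGroup F] [NormedSpace ℂ F]
    {T₁ T₂ : EllOne S →L[ℂ] F} (h : ∀ s, T₁ (basis hN s) = T₂ (basis hN s)) : T₁ = T₂ := by
  have : T₁.comp (moebius hN) = T₂.comp (moebius hN) := ext_delta h
  ext f
  simpa [moebius_zeta] using congrArg (fun T : EllOne S →L[ℂ] F => T (zeta hN f)) this

theorem ext_basis₂ {F : Type*} [NormedAddCommGroup F] [NormedSpace ℂ F]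
    {T₁ T₂ : EllOne S →L[ℂ] EllOne S →L[ℂ] F}
    (h : ∀ s t, T₁ (basis hN s) (basis hN t) = T₂ (basis hN s) (basis hN t)) : T₁ = T₂ :=
  ext_basis hN fun s => ext_basis hN fun t => h s t

end Zeta

/-! ### The groupoid product -/

section GroupoidProduct

variable {S : Type*} [InverseSemigroup S]

open Classical in
/-- The restricted product of point masses. -/
noncomputable def groupoidDelta (s t : S) : EllOne S :=
  if s⁻¹ * s = t * t⁻¹ then delta (s * t) else 0

theorem norm_groupoidDelta_le (s t : S) : ‖groupoidDelta s t‖ ≤ 1 := by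
  unfold groupoidDelta
  split_ifs <;> simp [norm_delta]

variable (S) in
/-- Convolution over the groupoid of restricted products. -/
noncomputable def groupoidMul : EllOne S →L[ℂ] EllOne S →L[ℂ] EllOne S :=
  lift (fun s => lift (groupoidDelta s) 1 (norm_groupoidDelta_le s)) 1
    fun _ => norm_lift_le _ _ zero_le_one _

theorem groupoidMul_delta (s t : S) : groupoidMul S (delta s) (delta t) = groupoidDelta s t := by
  rw [groupoidMul, lift_delta, lift_delta]

variable {N : ℕ} (hN : ∀ s : S, (below s).encard ≤ N)

/-- Both sides sum over the same set: r below st corresponds to the composable pair (rr⁻¹s, s⁻¹r),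
with inverse (x, y) ↦ xy. -/
theorem zeta_delta_mul (s t : S) :
    zeta hN (delta (s * t)) = groupoidMul S (zeta hN (delta s)) (zeta hN (delta t)) := by
  classical
  simp only [zeta_delta, map_sum, sum_apply, groupoidMul_delta]
  rw [Finset.sum_comm, ← Finset.sum_product']
  simp only [groupoidDelta]
  rw [← Finset.sum_filter]
  refine Finset.sum_bij' (fun r _ => (r * r⁻¹ * s, s⁻¹ * r)) (fun x _ => x.1 * x.2) ?_ ?_ ?_ ?_ ?_
  · intro r hr
    obtain ⟨h1, h2, h3, -⟩ := below_mul_factor ((mem_ideal hN).mp hr)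
    simp only [Finset.mem_filter, Finset.mem_product, mem_ideal]
    exact ⟨⟨h1, h2⟩, h3⟩
  · rintro ⟨x, y⟩ hx
    simp only [Finset.mem_filter, Finset.mem_product, mem_ideal] at hx ⊢
    exact (mul_mem_below hx.1.1 hx.1.2 hx.2).1
  · intro r hr
    exact (below_mul_factor ((mem_ideal hN).mp hr)).2.2.2
  · rintro ⟨x, y⟩ hx
    simp only [Finset.mem_filter, Finset.mem_product, mem_ideal] at hx
    exact Prod.ext (mul_mem_below hx.1.1 hx.1.2 hx.2).2.1 (mul_mem_below hx.1.1 hx.1.2 hx.2).2.2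
  · intro r hr
    rw [(below_mul_factor ((mem_ideal hN).mp hr)).2.2.2]

theorem zeta_mul (f g : EllOne S) :
    zeta hN (f * g) = groupoidMul S (zeta hN f) (zeta hN g) := by
  have : (ContinuousLinearMap.compL ℂ _ _ _ (zeta hN)).comp mulCLM =
      (groupoidMul S).bilinearComp (zeta hN) (zeta hN) := by
    refine ext_delta fun s => ext_delta fun t => ?_
    simp only [ContinuousLinearMap.comp_apply, ContinuousLinearMap.compL_apply, mulCLM_apply,
      ContinuousLinearMap.bilinearComp_apply, delta_mul_delta, zeta_delta_mul]
  exact congrArg (fun T : EllOne S →L[ℂ] EllOne S →L[ℂ] EllOne S => T f g) this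

/-- With `basis_mul_basis_of_ne`, this identifies ℓ¹(S) with the ℓ¹ algebra of its groupoid. -/
theorem basis_mul_basis {s t : S} (h : s⁻¹ * s = t * t⁻¹) :
    basis hN s * basis hN t = basis hN (s * t) := by
  rw [← moebius_zeta hN (basis hN s * basis hN t), zeta_mul, zeta_basis, zeta_basis,
    groupoidMul_delta, groupoidDelta, if_pos h, basis]

theorem basis_mul_basis_of_ne {s t : S} (h : s⁻¹ * s ≠ t * t⁻¹) :
    basis hN s * basis hN t = 0 := by
  rw [← moebius_zeta hN (basis hN s * basis hN t), zeta_mul, zeta_basis, zeta_basis,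
    groupoidMul_delta, groupoidDelta, if_neg h, map_zero]

end GroupoidProduct

end EllOne

/-! ### Universal property of the projective tensor product -/

namespace ProjTensor

theorem update_vec_zero {X : Type*} (a a' b : X) :
    Function.update (![a, b] : Fin 2 → X) 0 a' = ![a', b] := by
  ext i; fin_cases i <;> rfl

theorem update_vec_one {X : Type*} (a b b' : X) :
    Function.update (![a, b] : Fin 2 → X) 1 b' = ![a, b'] := by
  ext i; fin_cases i <;> rfl

variable {A : Type*} [NonUnitalNormedRing A] [NormedSpace ℂ A]

variable {F : Type*} [NormedAddCommGroup F] [NormedSpace ℂ F]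

/-- A bounded bilinear map as a continuous multilinear map indexed by `Fin 2`. -/
noncomputable def multilinearOfBilinear (B : A →L[ℂ] A →L[ℂ] F) :
    ContinuousMultilinearMap ℂ (fun _ : Fin 2 => A) F :=
  MultilinearMap.mkContinuous
    { toFun := fun m => B (m 0) (m 1)
      map_update_add' := by
        intro _ m i x y
        fin_cases i <;> simp [Function.update]
      map_update_smul' := by
        intro _ m i c x
        fin_cases i <;> simp [Function.update] }
    ‖B‖ (fun m => by simpa [Fin.prod_univ_two, mul_assoc] using B.le_opNorm₂ (m 0) (m 1))

/-- The universal property of the projective tensor product. -/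
noncomputable def lift [CompleteSpace F] (B : A →L[ℂ] A →L[ℂ] F) : ProjTensor A →L[ℂ] F :=
  extend (PiTensorProduct.liftIsometry ℂ (fun _ : Fin 2 => A) F (multilinearOfBilinear B))

theorem lift_tmul [CompleteSpace F] (B : A →L[ℂ] A →L[ℂ] F) (a b : A) :
    lift B (tmul a b) = B a b := by
  rw [lift, tmul, extend_coe, PiTensorProduct.liftIsometry_apply_apply,
    PiTensorProduct.lift.tprod]
  rfl

theorem norm_tmul_le (a b : A) : ‖tmul a b‖ ≤ ‖a‖ * ‖b‖ := by
  rw [tmul, UniformSpace.Completion.norm_coe]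
  refine (PiTensorProduct.projectiveSeminorm_tprod_le _).trans ?_
  simp [Fin.prod_univ_two]

theorem tmul_eq (a b : A) :
    tmul a b = UniformSpace.Completion.toComplL (𝕜 := ℂ)
      (PiTensorProduct.tprod ℂ (![a, b] : Fin 2 → A)) := rfl

variable (A) in
/-- The elementary tensor as a bounded bilinear map. -/
noncomputable def tmulL : A →L[ℂ] A →L[ℂ] ProjTensor A :=
  LinearMap.mkContinuous₂
    (LinearMap.mk₂ ℂ (fun a b : A => tmul a b)
      (fun a a' b => by
        have := (PiTensorProduct.tprod ℂ (s := fun _ : Fin 2 => A)).map_update_add ![0, b] 0 a a'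
        simp only [tmul_eq, ← map_add]
        congr 1
        simpa only [update_vec_zero, update_vec_one] using this)
      (fun c a b => by
        have := (PiTensorProduct.tprod ℂ (s := fun _ : Fin 2 => A)).map_update_smul ![0, b] 0 c a
        simp only [tmul_eq, ← map_smul]
        congr 1
        simpa only [update_vec_zero, update_vec_one] using this)
      (fun a b b' => by
        have := (PiTensorProduct.tprod ℂ (s := fun _ : Fin 2 => A)).map_update_add ![a, 0] 1 b b'
        simp only [tmul_eq, ← map_add]
        congr 1
        simpa only [update_vec_zero, update_vec_one] using this)
      (fun c a b => by
        have := (PiTensorProduct.tprod ℂ (s := fun _ : Fin 2 => A)).map_update_smul ![a, 0] 1 c b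
        simp only [tmul_eq, ← map_smul]
        congr 1
        simpa only [update_vec_zero, update_vec_one] using this)) 1
    (fun a b => by simpa using norm_tmul_le a b)

theorem tmulL_apply (a b : A) : tmulL A a b = tmul a b := rfl

theorem tmul_zero (a : A) : tmul a (0 : A) = 0 := (tmulL A a).map_zero

theorem zero_tmul (b : A) : tmul (0 : A) b = 0 := by
  rw [← tmulL_apply, map_zero, zero_apply]

end ProjTensor

/-! ### 𝓓-classes and arrows to a base point -/

namespace InverseSemigroup

variable {S : Type*} [InverseSemigroup S]

variable (S) in
/-- Green's relation `𝓓`. -/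
def greenD : Setoid S where
  r s t := ∃ u : S, u * u⁻¹ = s * s⁻¹ ∧ u⁻¹ * u = t * t⁻¹
  iseqv :=
    { refl := fun s => ⟨s * s⁻¹, range_idem (isIdempotentElem_mul_inv s),
        source_idem (isIdempotentElem_mul_inv s)⟩
      symm := by
        rintro s t ⟨u, h1, h2⟩
        exact ⟨u⁻¹, by rw [inv_inv_eq, h2], by rw [inv_inv_eq, h1]⟩
      trans := by
        rintro r s t ⟨u, h1, h2⟩ ⟨v, h3, h4⟩
        have h := h2.trans h3.symm
        exact ⟨u * v, by rw [range_mul h, h1], by rw [source_mul h, h4]⟩ }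

/-- A chosen representative of the `𝓓`-class of `s`. -/
noncomputable def dRep (s : S) : S := (Quotient.mk (greenD S) s).out

theorem dRep_rel (s : S) : (greenD S).r s (dRep s) :=
  (greenD S).symm (Quotient.mk_out (s := greenD S) s)

theorem dRep_congr {s t : S} (h : (greenD S).r s t) : dRep s = dRep t := by
  unfold dRep
  rw [Quotient.sound (s := greenD S) h]

theorem dRep_mul {s t : S} (h : s⁻¹ * s = t * t⁻¹) : dRep (s * t) = dRep t :=
  dRep_congr ⟨s, (range_mul h).symm, h⟩

theorem dRep_mul_left {s t : S} (h : s⁻¹ * s = t * t⁻¹) : dRep (s * t) = dRep s :=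
  (dRep_mul h).trans (dRep_congr ⟨s, rfl, h⟩).symm

/-- The elements with the same range as `s` whose source is the range of `dRep s`. -/
def arrows (s : S) : Set S := {u | u * u⁻¹ = s * s⁻¹ ∧ u⁻¹ * u = dRep s * (dRep s)⁻¹}

theorem arrows_nonempty (s : S) : (arrows s).Nonempty := dRep_rel s

/-- Left translation by v⁻¹, for one fixed arrow v, embeds the arrows into the maximal subgroup at
the base point. -/
theorem arrows_finite (hG : ∀ p : Idempotents S, (maximalSubgroup p).Finite) (s : S) :
    (arrows s).Finite := by
  obtain ⟨v, hv1, hv2⟩ := arrows_nonempty s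
  refine Set.Finite.of_finite_image (f := fun u => v⁻¹ * u)
    ((hG ⟨dRep s * (dRep s)⁻¹, isIdempotentElem_mul_inv _⟩).subset ?_) ?_
  · rintro _ ⟨u, ⟨hu1, hu2⟩, rfl⟩
    have h : v⁻¹⁻¹ * v⁻¹ = u * u⁻¹ := by rw [inv_inv_eq, hv1, hu1]
    exact ⟨by rw [range_mul h, inv_inv_eq, hv2], by rw [source_mul h, hu2]⟩
  · rintro u ⟨hu, -⟩ u' ⟨hu', -⟩ h
    have h' : v * (v⁻¹ * u) = v * (v⁻¹ * u') := congrArg (v * ·) h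
    rwa [mul_inv_cancel_of_eq (hv1.trans hu.symm), mul_inv_cancel_of_eq (hv1.trans hu'.symm)] at h'

/-- The arrows depend only on the range and the 𝓓-class, both unchanged by a composable right
factor. -/
theorem arrows_mul_left {s t : S} (h : s⁻¹ * s = t * t⁻¹) : arrows (s * t) = arrows s := by
  simp only [arrows, range_mul h, dRep_mul_left h]

theorem mul_mem_arrows {s t u : S} (h : s⁻¹ * s = t * t⁻¹) (hu : u ∈ arrows t) :
    s * u ∈ arrows (s * t) := by
  have hsu := h.trans hu.1.symm
  exact ⟨by rw [range_mul hsu, range_mul h], by rw [source_mul hsu, dRep_mul h, hu.2]⟩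

theorem inv_mul_mem_arrows {s t v : S} (h : s⁻¹ * s = t * t⁻¹) (hv : v ∈ arrows (s * t)) :
    s⁻¹ * v ∈ arrows t := by
  have hsv : s⁻¹⁻¹ * s⁻¹ = v * v⁻¹ := by rw [inv_inv_eq, hv.1, range_mul h]
  exact ⟨by rw [range_mul hsv, inv_inv_eq, h], by rw [source_mul hsv, hv.2, dRep_mul h]⟩

end InverseSemigroup

namespace EllOne

open InverseSemigroup

variable {S : Type*} [InverseSemigroup S] {N : ℕ} (hN : ∀ s : S, (below s).encard ≤ N)

/-! ### Finite maximal subgroups give biprojectivity -/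

section Splitting

variable (hA : ∀ s : S, (arrows s).Finite)

/-- The average of `⌊u⌋ ⊗ ⌊u⁻¹ s⌋` over `arrows s`. -/
noncomputable def diagonal (s : S) : ProjTensor (EllOne S) :=
  ((hA s).toFinset.card : ℂ)⁻¹ •
    ∑ u ∈ (hA s).toFinset, ProjTensor.tmul (basis hN u) (basis hN (u⁻¹ * s))

theorem card_arrows_ne_zero (s : S) : ((hA s).toFinset.card : ℂ) ≠ 0 := by
  rw [Nat.cast_ne_zero, Finset.card_ne_zero, Set.Finite.toFinset_nonempty]
  exact arrows_nonempty s

/-- Averaging makes the bound independent of the number of arrows, so the maximal subgroups need not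
have bounded order. -/
theorem norm_diagonal_le (s : S) :
    ‖diagonal hN hA s‖ ≤ ‖moebius hN‖ * ‖moebius hN‖ := by
  rw [diagonal, norm_smul, norm_inv, inv_mul_le_iff₀ (norm_pos_iff.mpr (card_arrows_ne_zero hA s))]
  refine (norm_sum_le _ _).trans ((Finset.sum_le_card_nsmul _ _ (‖moebius hN‖ * ‖moebius hN‖)
    fun u _ => (ProjTensor.norm_tmul_le _ _).trans ?_).trans ?_)
  · exact mul_le_mul (norm_basis_le hN _) (norm_basis_le hN _) (norm_nonneg _) (norm_nonneg _)
  · simp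

theorem sum_arrows_mul {M : Type*} [AddCommMonoid M] {s t : S} (h : s⁻¹ * s = t * t⁻¹)
    (f : S → M) :
    ∑ u ∈ (hA t).toFinset, f (s * u) = ∑ v ∈ (hA (s * t)).toFinset, f v := by
  refine Finset.sum_bij' (fun u _ => s * u) (fun v _ => s⁻¹ * v) ?_ ?_ ?_ ?_ fun _ _ => rfl
  · intro u hu
    simp only [Set.Finite.mem_toFinset] at hu ⊢
    exact mul_mem_arrows h hu
  · intro u hu
    simp only [Set.Finite.mem_toFinset] at hu ⊢
    exact inv_mul_mem_arrows h hu
  · intro u hu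
    rw [Set.Finite.mem_toFinset] at hu
    exact inv_mul_cancel_of_eq (h.trans hu.1.symm)
  · intro u hu
    rw [Set.Finite.mem_toFinset] at hu
    exact mul_inv_cancel_of_eq ((range_mul h).symm.trans hu.1.symm)

/-- Reindex by u ↦ su: the second legs agree because (su)⁻¹(st) = u⁻¹t. -/
theorem lact_diagonal {s t : S} (h : s⁻¹ * s = t * t⁻¹) :
    ProjTensor.lact (basis hN s) (diagonal hN hA t) = diagonal hN hA (s * t) := by
  have hcard : (hA t).toFinset.card = (hA (s * t)).toFinset.card := by
    rw [Finset.card_eq_sum_ones, Finset.card_eq_sum_ones]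
    exact sum_arrows_mul hA h fun _ => 1
  rw [diagonal, diagonal, map_smul, map_sum, hcard, ← sum_arrows_mul hA h]
  congr 1
  refine Finset.sum_congr rfl fun u hu => ?_
  rw [Set.Finite.mem_toFinset] at hu
  have hsu := h.trans hu.1.symm
  rw [ProjTensor.lact_tmul, basis_mul_basis hN hsu, inv_mul_eq, mul_assoc,
    inv_mul_cancel_of_eq h]

theorem lact_diagonal_of_ne {s t : S} (h : s⁻¹ * s ≠ t * t⁻¹) :
    ProjTensor.lact (basis hN s) (diagonal hN hA t) = 0 := by
  rw [diagonal, map_smul, map_sum, Finset.sum_eq_zero, smul_zero]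
  intro u hu
  rw [Set.Finite.mem_toFinset] at hu
  rw [ProjTensor.lact_tmul, basis_mul_basis_of_ne hN (by rwa [hu.1]), ProjTensor.zero_tmul]

theorem source_inv_mul {s u : S} (hu : u ∈ arrows s) : (u⁻¹ * s)⁻¹ * (u⁻¹ * s) = s⁻¹ * s :=
  source_mul (by rw [inv_inv_eq, hu.1])

/-- The index set is unchanged, and (u⁻¹s)t = u⁻¹(st) term by term. -/
theorem ract_diagonal {s t : S} (h : s⁻¹ * s = t * t⁻¹) :
    ProjTensor.ract (basis hN t) (diagonal hN hA s) = diagonal hN hA (s * t) := by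
  have hset : (hA (s * t)).toFinset = (hA s).toFinset := by
    ext; simp [arrows_mul_left h]
  rw [diagonal, diagonal, map_smul, map_sum, hset]
  congr 1
  refine Finset.sum_congr rfl fun u hu => ?_
  rw [Set.Finite.mem_toFinset] at hu
  rw [ProjTensor.ract_tmul, basis_mul_basis hN ((source_inv_mul hu).trans h), mul_assoc]

theorem ract_diagonal_of_ne {s t : S} (h : s⁻¹ * s ≠ t * t⁻¹) :
    ProjTensor.ract (basis hN t) (diagonal hN hA s) = 0 := by
  rw [diagonal, map_smul, map_sum, Finset.sum_eq_zero, smul_zero]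
  intro u hu
  rw [Set.Finite.mem_toFinset] at hu
  rw [ProjTensor.ract_tmul, basis_mul_basis_of_ne hN (by rwa [source_inv_mul hu]),
    ProjTensor.tmul_zero]

theorem prodMap_diagonal (s : S) :
    ProjTensor.prodMap (EllOne S) (diagonal hN hA s) = basis hN s := by
  have : ∀ u ∈ (hA s).toFinset, ProjTensor.prodMap (EllOne S)
      (ProjTensor.tmul (basis hN u) (basis hN (u⁻¹ * s))) = basis hN s := by
    intro u hu
    rw [Set.Finite.mem_toFinset] at hu
    have hus : u⁻¹⁻¹ * u⁻¹ = s * s⁻¹ := by rw [inv_inv_eq, hu.1]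
    rw [ProjTensor.prodMap_tmul, basis_mul_basis hN (by rw [range_mul hus, inv_inv_eq]),
      mul_inv_cancel_of_eq hu.1]
  rw [diagonal, map_smul, map_sum, Finset.sum_congr rfl this, Finset.sum_const,
    ← Nat.cast_smul_eq_nsmul ℂ, smul_smul, inv_mul_cancel₀ (card_arrows_ne_zero hA s), one_smul]

/-- The splitting of the product morphism. -/
noncomputable def splitting : EllOne S →L[ℂ] ProjTensor (EllOne S) :=
  (lift (diagonal hN hA) _ (norm_diagonal_le hN hA)).comp (zeta hN)

theorem splitting_basis (s : S) : splitting hN hA (basis hN s) = diagonal hN hA s := by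
  rw [splitting, ContinuousLinearMap.comp_apply, zeta_basis, lift_delta]

theorem splitting_left (a b : EllOne S) :
    splitting hN hA (a * b) = ProjTensor.lact a (splitting hN hA b) := by
  have h1 : ∀ (a : EllOne S) (t : S), splitting hN hA (a * basis hN t) =
      ProjTensor.lact a (splitting hN hA (basis hN t)) := by
    intro a t
    -- Packages a ↦ a · ρ(⌊t⌋) as a bounded linear map in a, so that the identity need only be
    -- checked for a in the Möbius basis.
    let T : EllOne S →L[ℂ] ProjTensor (EllOne S) := ((hA t).toFinset.card : ℂ)⁻¹ •
      ∑ u ∈ (hA t).toFinset, ((ProjTensor.tmulL (EllOne S)).flip (basis hN (u⁻¹ * t))).comp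
        (mulCLM.flip (basis hN u))
    have hT : ∀ a, T a = ProjTensor.lact a (splitting hN hA (basis hN t)) := by
      intro a
      simp only [T, splitting_basis, diagonal, map_smul, map_sum, ProjTensor.lact_tmul]
      simp only [smul_apply, sum_apply, ContinuousLinearMap.comp_apply,
        ContinuousLinearMap.flip_apply, mulCLM_apply, ProjTensor.tmulL_apply]
    have : (splitting hN hA).comp (mulCLM.flip (basis hN t)) = T := by
      refine ext_basis hN fun s => ?_
      rw [hT, splitting_basis, ContinuousLinearMap.comp_apply, ContinuousLinearMap.flip_apply,
        mulCLM_apply]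
      by_cases h : s⁻¹ * s = t * t⁻¹
      · rw [basis_mul_basis hN h, splitting_basis, lact_diagonal hN hA h]
      · rw [basis_mul_basis_of_ne hN h, map_zero, lact_diagonal_of_ne hN hA h]
    rw [← hT, ← this]
    rfl
  have : (splitting hN hA).comp (mulCLM a) = (ProjTensor.lact a).comp (splitting hN hA) :=
    ext_basis hN fun t => h1 a t
  exact congrArg (fun T : EllOne S →L[ℂ] ProjTensor (EllOne S) => T b) this

theorem splitting_right (a b : EllOne S) :
    splitting hN hA (a * b) = ProjTensor.ract b (splitting hN hA a) := by
  have h1 : ∀ (b : EllOne S) (s : S), splitting hN hA (basis hN s * b) =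
      ProjTensor.ract b (splitting hN hA (basis hN s)) := by
    intro b s
    let T : EllOne S →L[ℂ] ProjTensor (EllOne S) := ((hA s).toFinset.card : ℂ)⁻¹ •
      ∑ u ∈ (hA s).toFinset, (ProjTensor.tmulL (EllOne S) (basis hN u)).comp
        (mulCLM (basis hN (u⁻¹ * s)))
    have hT : ∀ b, T b = ProjTensor.ract b (splitting hN hA (basis hN s)) := by
      intro b
      simp only [T, splitting_basis, diagonal, map_smul, map_sum, ProjTensor.ract_tmul]
      simp only [smul_apply, sum_apply, ContinuousLinearMap.comp_apply,
        mulCLM_apply, ProjTensor.tmulL_apply]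
    have : (splitting hN hA).comp (mulCLM (basis hN s)) = T := by
      refine ext_basis hN fun t => ?_
      rw [hT, splitting_basis, ContinuousLinearMap.comp_apply, mulCLM_apply]
      by_cases h : s⁻¹ * s = t * t⁻¹
      · rw [basis_mul_basis hN h, splitting_basis, ract_diagonal hN hA h]
      · rw [basis_mul_basis_of_ne hN h, map_zero, ract_diagonal_of_ne hN hA h]
    rw [← hT, ← this]
    rfl
  have : (splitting hN hA).comp (mulCLM.flip b) = (ProjTensor.ract b).comp (splitting hN hA) :=
    ext_basis hN fun s => h1 b s
  exact congrArg (fun T : EllOne S →L[ℂ] ProjTensor (EllOne S) => T a) this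

theorem isBiprojective_of_finite (hN : ∀ s : S, (below s).encard ≤ N)
    (hG : ∀ p : Idempotents S, (maximalSubgroup p).Finite) : IsBiprojective (EllOne S) := by
  have hA := arrows_finite hG
  refine ⟨splitting hN hA, fun a b => ⟨splitting_left hN hA a b, splitting_right hN hA a b⟩, ?_⟩
  have : (ProjTensor.prodMap (EllOne S)).comp (splitting hN hA) = ContinuousLinearMap.id ℂ _ := by
    refine ext_basis hN fun s => ?_
    rw [ContinuousLinearMap.comp_apply, splitting_basis, prodMap_diagonal]
    rfl
  exact fun a => congrArg (fun T : EllOne S →L[ℂ] EllOne S => T a) this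

end Splitting

/-! ### Approximate biprojectivity forces finite maximal subgroups -/

section Coefficients

/-- The bilinear map `(δ_x, δ_y) ↦ δ_{(x, y)}`. -/
noncomputable def pairing : EllOne S →L[ℂ] EllOne S →L[ℂ] EllOne (S × S) :=
  lift (fun x => lift (fun y => delta (x, y)) 1 fun _ => (norm_delta _).le) 1
    fun _ => norm_lift_le _ _ zero_le_one _

/-- The coefficients of an element of the projective tensor square in the Möbius basis. -/
noncomputable def coeffs : ProjTensor (EllOne S) →L[ℂ] EllOne (S × S) :=
  ProjTensor.lift (pairing.bilinearComp (zeta hN) (zeta hN))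

theorem coeffs_tmul_basis (s t : S) :
    coeffs hN (ProjTensor.tmul (basis hN s) (basis hN t)) = delta (s, t) := by
  rw [coeffs, ProjTensor.lift_tmul, ContinuousLinearMap.bilinearComp_apply, zeta_basis,
    zeta_basis, pairing, lift_delta, lift_delta]

theorem ext_tmul_basis {F : Type*} [NormedAddCommGroup F] [NormedSpace ℂ F]
    {T₁ T₂ : ProjTensor (EllOne S) →L[ℂ] F}
    (h : ∀ s t, T₁ (ProjTensor.tmul (basis hN s) (basis hN t)) =
      T₂ (ProjTensor.tmul (basis hN s) (basis hN t))) : T₁ = T₂ := by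
  refine ProjTensor.ext_tmul fun a b => ?_
  have : (ContinuousLinearMap.compL ℂ _ _ _ T₁).comp (ProjTensor.tmulL (EllOne S)) =
      (ContinuousLinearMap.compL ℂ _ _ _ T₂).comp (ProjTensor.tmulL (EllOne S)) :=
    ext_basis₂ hN h
  exact congrArg (fun T : EllOne S →L[ℂ] EllOne S →L[ℂ] F => T a b) this

/-- Evaluation at `x`. -/
noncomputable def coord {X : Type*} (x : X) : EllOne X →L[ℂ] ℂ := lp.evalCLM ℂ (fun _ => ℂ) 1 x

theorem coord_apply {X : Type*} (x : X) (f : EllOne X) : coord x f = f x := rfl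

open Classical in
theorem delta_apply {X : Type*} (x y : X) : delta x y = if y = x then 1 else 0 := by
  split_ifs with h
  · rw [h, delta_self]
  · exact delta_ne h

/-- The element ⌊g⌋ kills ⌊s⌋ ⊗ ⌊t⌋ or moves it to ⌊gs⌋ ⊗ ⌊t⌋, and groupoid cancellation leaves s =
x as the only source of gx. -/
theorem coeffs_lact {g x y : S} (h : g⁻¹ * g = x * x⁻¹) (ξ : ProjTensor (EllOne S)) :
    coeffs hN (ProjTensor.lact (basis hN g) ξ) (g * x, y) = coeffs hN ξ (x, y) := by
  have : (coord (g * x, y)).comp ((coeffs hN).comp (ProjTensor.lact (basis hN g))) =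
      (coord (x, y)).comp (coeffs hN) := by
    refine ext_tmul_basis hN fun s t => ?_
    simp only [ContinuousLinearMap.comp_apply, ProjTensor.lact_tmul, coeffs_tmul_basis]
    by_cases hs : g⁻¹ * g = s * s⁻¹
    · rw [basis_mul_basis hN hs, coeffs_tmul_basis, coord_apply, coord_apply, delta_apply,
        delta_apply]
      congr 1
      rw [Prod.mk.injEq, Prod.mk.injEq, eq_iff_iff]
      refine and_congr_left fun _ => ⟨fun he => ?_, fun he => by rw [he]⟩
      rw [← inv_mul_cancel_of_eq h, he, inv_mul_cancel_of_eq hs]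
    · rw [basis_mul_basis_of_ne hN hs, ProjTensor.zero_tmul, map_zero, map_zero, coord_apply,
        delta_ne]
      intro he
      exact hs ((Prod.mk.inj he).1 ▸ h)
  exact congrArg (fun T : ProjTensor (EllOne S) →L[ℂ] ℂ => T ξ) this

theorem coeffs_ract {g x y : S} (h : y⁻¹ * y = g * g⁻¹) (ξ : ProjTensor (EllOne S)) :
    coeffs hN (ProjTensor.ract (basis hN g) ξ) (x, y * g) = coeffs hN ξ (x, y) := by
  have : (coord (x, y * g)).comp ((coeffs hN).comp (ProjTensor.ract (basis hN g))) =
      (coord (x, y)).comp (coeffs hN) := by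
    refine ext_tmul_basis hN fun s t => ?_
    simp only [ContinuousLinearMap.comp_apply, ProjTensor.ract_tmul, coeffs_tmul_basis]
    by_cases ht : t⁻¹ * t = g * g⁻¹
    · rw [basis_mul_basis hN ht, coeffs_tmul_basis, coord_apply, coord_apply, delta_apply,
        delta_apply]
      congr 1
      rw [Prod.mk.injEq, Prod.mk.injEq, eq_iff_iff]
      refine and_congr_right fun _ => ⟨fun he => ?_, fun he => by rw [he]⟩
      rw [← mul_cancel_right_of_eq h, he, mul_cancel_right_of_eq ht]
    · rw [basis_mul_basis_of_ne hN ht, ProjTensor.tmul_zero, map_zero, map_zero, coord_apply,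
        delta_ne]
      intro he
      exact ht ((Prod.mk.inj he).2 ▸ h)
  exact congrArg (fun T : ProjTensor (EllOne S) →L[ℂ] ℂ => T ξ) this

/-- The coefficient of π(ξ) at ⌊p⌋ is the sum of the coefficients of ξ over the groupoid
factorizations of p; v is their indicator function. -/
theorem coord_zeta_prodMap_eq_zero (p : S) (ξ : ProjTensor (EllOne S))
    (h : ∀ x y : S, x⁻¹ * x = y * y⁻¹ → x * y = p → coeffs hN ξ (x, y) = 0) :
    coord p (zeta hN (ProjTensor.prodMap (EllOne S) ξ)) = 0 := by
  classical
  let v : S × S → ℂ := fun z => if z.1⁻¹ * z.1 = z.2 * z.2⁻¹ ∧ z.1 * z.2 = p then 1 else 0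
  have hv : ∀ z, ‖v z‖ ≤ 1 := fun z => by
    simp only [v]
    split_ifs <;> simp
  have key : (coord p).comp ((zeta hN).comp (ProjTensor.prodMap (EllOne S))) =
      (lift v 1 hv).comp (coeffs hN) := by
    refine ext_tmul_basis hN fun s t => ?_
    simp only [ContinuousLinearMap.comp_apply, ProjTensor.prodMap_tmul, coeffs_tmul_basis,
      lift_delta, v]
    by_cases hst : s⁻¹ * s = t * t⁻¹
    · simp only [basis_mul_basis hN hst, zeta_basis, coord_apply, delta_apply, hst, true_and,
        eq_comm]
    · simp only [basis_mul_basis_of_ne hN hst, map_zero, hst, false_and, if_false]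
  refine (congrArg (fun T : ProjTensor (EllOne S) →L[ℂ] ℂ => T ξ) key).trans ?_
  change lift v 1 hv (coeffs hN ξ) = 0
  rw [lift_apply]
  refine (tsum_congr fun z => ?_).trans tsum_zero
  simp only [v]
  split_ifs with hz
  · rw [h z.1 z.2 hz.1 hz.2, zero_smul]
  · rw [smul_zero]

/-- A summable family that is constant along an infinite orbit of `G_p` vanishes on that orbit. -/
theorem coeffs_eq_zero_of_infinite {p : Idempotents S} (hp : (maximalSubgroup p).Infinite)
    {ρ : EllOne S →L[ℂ] ProjTensor (EllOne S)} (hρ : IsBimoduleMorphism ρ) {x y : S}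
    (hx : x * x⁻¹ = p.1) (hy : y⁻¹ * y = p.1) :
    coeffs hN (ρ (basis hN p.1)) (x, y) = 0 := by
  have hpr := range_idem p.2
  have hps := source_idem p.2
  have hleft : ∀ g ∈ maximalSubgroup p,
      ProjTensor.lact (basis hN g) (ρ (basis hN p.1)) = ρ (basis hN g) := by
    intro g hg
    have h : g⁻¹ * g = p.1 * p.1⁻¹ := by rw [hg.2, hpr]
    rw [← (hρ _ _).1, basis_mul_basis hN h, ← hg.2, mul_inv_mul']
  have hright : ∀ g ∈ maximalSubgroup p,
      ProjTensor.ract (basis hN g) (ρ (basis hN p.1)) = ρ (basis hN g) := by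
    intro g hg
    have h : p.1⁻¹ * p.1 = g * g⁻¹ := by rw [hg.1, hps]
    rw [← (hρ _ _).2, basis_mul_basis hN h, ← hg.1, mul_inv_mul]
  have hconst : ∀ g : maximalSubgroup p,
      coeffs hN (ρ (basis hN p.1)) (g.1 * x, y * g.1⁻¹) =
        coeffs hN (ρ (basis hN p.1)) (x, y) := by
    rintro ⟨g, hg⟩
    have h1 : g⁻¹ * g = x * x⁻¹ := by rw [hg.2, hx]
    have h2 : y⁻¹ * y = g⁻¹ * g⁻¹⁻¹ := by rw [inv_inv_eq, hg.2, hy]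
    have h3 : (y * g⁻¹)⁻¹ * (y * g⁻¹) = g * g⁻¹ := by rw [source_mul h2, inv_inv_eq]
    have h4 : y * g⁻¹ * g = y := by
      have := mul_cancel_right_of_eq h2
      rwa [inv_inv_eq] at this
    -- Compare the coefficients of ⌊g⌋·ρ(⌊p⌋) and ρ(⌊p⌋)·⌊g⌋, both equal to ρ(⌊g⌋), at (gx, y).
    have e1 := coeffs_ract hN (x := g * x) h3 (ρ (basis hN p.1))
    rw [h4, hright g hg, ← hleft g hg, coeffs_lact hN h1] at e1
    exact e1.symm
  have hinj : Function.Injective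
      fun g : maximalSubgroup p => ((g.1 * x, y * g.1⁻¹) : S × S) := by
    rintro ⟨g, hg⟩ ⟨k, hk⟩ h
    have h1 : g * x = k * x := (Prod.mk.inj h).1
    have hgx : g⁻¹ * g = x * x⁻¹ := by rw [hg.2, hx]
    have hkx : k⁻¹ * k = x * x⁻¹ := by rw [hk.2, hx]
    refine Subtype.ext ?_
    change g = k
    rw [← mul_cancel_right_of_eq hgx, h1, mul_cancel_right_of_eq hkx]
  have hs := (summable_norm (coeffs hN (ρ (basis hN p.1)))).comp_injective hinj
  have := hp.to_subtype
  have hs' : Summable fun _ : maximalSubgroup p => ‖coeffs hN (ρ (basis hN p.1)) (x, y)‖ := by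
    refine hs.congr fun g => ?_
    simp only [Function.comp_apply, hconst g]
  exact norm_eq_zero.mp
    (tendsto_nhds_unique tendsto_const_nhds hs'.tendsto_cofinite_zero)

theorem finite_of_isApproximatelyBiprojective (hN : ∀ s : S, (below s).encard ≤ N)
    (h : IsApproximatelyBiprojective (EllOne S))
    (p : Idempotents S) : (maximalSubgroup p).Finite := by
  by_contra hp
  obtain ⟨ι, _, _, _, ρ, hρ, hlim⟩ := h
  have hzero : ∀ i, coord p.1
      (zeta hN (ProjTensor.prodMap (EllOne S) (ρ i (basis hN p.1)))) = 0 := fun i => by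
    refine coord_zeta_prodMap_eq_zero hN _ _ fun x y hxy hp' =>
      coeffs_eq_zero_of_infinite hN hp (hρ i) ?_ ?_
    · rw [← range_mul hxy, hp', range_idem p.2]
    · rw [← source_mul hxy, hp', source_idem p.2]
  -- The coefficient functional at ⌊p⌋ is continuous, is 0 along the net and is 1 at the limit.
  have ht := (((coord p.1).comp (zeta hN)).continuous.tendsto _).comp (hlim (basis hN p.1))
  have h1 : ((coord p.1).comp (zeta hN)) (basis hN p.1) = 1 := by
    rw [ContinuousLinearMap.comp_apply, zeta_basis, coord_apply, delta_self]
  rw [h1] at ht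
  exact zero_ne_one (tendsto_nhds_unique (ht.congr hzero) tendsto_const_nhds).symm

end Coefficients

end EllOne

/-! ### The equivalences -/

theorem IsBiprojective.isApproximatelyBiprojective {A : Type*} [NonUnitalNormedRing A]
    [NormedSpace ℂ A] [IsScalarTower ℂ A A] [SMulCommClass ℂ A A] [CompleteSpace A]
    (h : IsBiprojective A) : IsApproximatelyBiprojective A := by
  obtain ⟨ρ, hρ, hπ⟩ := h
  refine ⟨PUnit, inferInstance, inferInstance, inferInstance, fun _ => ρ, fun _ => hρ, fun a => ?_⟩
  simp only [hπ]
  exact tendsto_const_nhds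

theorem mainTheorem1 {S : Type*} [InverseSemigroup S]
    (hE : UniformlyLocallyFinite (Idempotents S)) :
    (IsApproximatelyBiprojective (EllOne S) ↔ IsBiprojective (EllOne S)) ∧
      (IsApproximatelyBiprojective (EllOne S) ↔
        ∀ p : Idempotents S, (maximalSubgroup p).Finite) := by
  obtain ⟨N, hN⟩ := hE
  have hN' := InverseSemigroup.encard_below_le hN
  have h1 := EllOne.finite_of_isApproximatelyBiprojective hN'
  have h2 := EllOne.isBiprojective_of_finite hN'
  have h3 := IsBiprojective.isApproximatelyBiprojective (A := EllOne S)
  exact ⟨⟨fun h => h2 (h1 h), h3⟩, ⟨h1, fun h => h3 (h2 h)⟩⟩
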